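/- Let an explicit Runge--Kutta scheme with $s$ stages be given by weights $b_i\in\mathbb C$ and coefficients $a_{ij}\in\mathbb C$ ($1\le j<i\le s$). For a linear system $u'=\mathbf L u$, $\mathbf L\in\mathbb C^{n\times n}$, and a time step $\tau>0$, one step of the scheme is $$u^1=u^0+\tau\sum_{i=1}^s b_iK_i,\qquad K_i=\mathbf L\Big(u^0+\tau\sum_{j=1}^{i-1}a_{ij}K_j\Big),\quad i=1,\dots,s.$$ Its stability function $R$ is the polynomial for which $R(z)$ is the value $u^1$ obtained for the scalar equation $u'=zu$ with $u^0=1$, $\tau=1$. Assume that it has real coefficients and write $R(z)=\sum_{j=0}^{s}c_j\frac{z^j}{j!}$ with $c_j\in\mathbb R$, and $c_j=0$ for $j>s$. The scheme has order $p$ (for linear systems) if, for every $n$, every $\mathbf L\in\mathbb C^{n\times n}$ and every solution $u$ of $u'=\mathbf L u$, one step started at $u^0=u(0)$ satisfies $u^1-u(\tau)=O(\tau^{p+1})$ as $\tau\to0^+$. A matrix $\mathbf L\in\mathbb C^{n\times n}$ is Lyapunov stable if all its eigenvalues have nonpositive real part and those with vanishing real part have equal algebraic and geometric multiplicity. The scheme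 is strongly stable if for all $n\in\mathbb N$, all Lyapunov stable $\mathbf L\in\mathbb C^{n\times n}$ and all Hermitian positive definite $\mathbf P\in\mathbb C^{n\times n}$ with $\mathbf L^*\mathbf P+\mathbf P\mathbf L\le0$ there is $\tau_0>0$ such that $\|u^1\|_{\mathbf P}\le\|u^0\|_{\mathbf P}$ for all $\tau\in(0,\tau_0]$ and all $u^0\in\mathbb C^n$, where $\|u\|_{\mathbf P}=\sqrt{\langle u,\mathbf P u\rangle}$. **Theorem.** Let $p\ge1$ and let the scheme be of order $p$. The scheme is not strongly stable in each of the following cases: - $p$ is odd and $(-1)^{(p+1)/2}(1-c_{p+1})<0$; - $p$ is even and at least one of the following two inequalities holds: $$(-1)^{p/2}\big(c_{p+2}-(p+2)c_{p+1}+(p+1)\big)<0,\qquad 1+(-1)^{p/2}(c_{p+1}-1)\binom{p}{p/2}<0.$$ -/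

import Mathlib

open scoped Matrix Topology Nat ComplexOrder

noncomputable section

/-- The coefficients of an explicit Runge–Kutta scheme with `s` stages: weights `b i` and
Runge–Kutta matrix `a i j`, of which only the entries with `j < i` enter the scheme. -/
structure ExplicitRK (s : ℕ) where
  a : Fin s → Fin s → ℂ
  b : Fin s → ℂ

namespace ExplicitRK

variable {s : ℕ} {V : Type*} [AddCommGroup V] [Module ℂ V]

/-- The stages `K i = f (u + τ ∑_{j < i} a i j • K j)` for the autonomous equation `u' = f u`. -/
def stage (rk : ExplicitRK s) (f : V → V) (τ : ℝ) (u : V) (i : Fin s) : V :=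
  f (u + (τ : ℂ) • ∑ j : Fin i.val,
    rk.a i ⟨j.val, j.isLt.trans i.isLt⟩ • stage rk f τ u ⟨j.val, j.isLt.trans i.isLt⟩)
termination_by i.val
decreasing_by exact j.isLt

/-- One step `u⁰ ↦ u¹ = u⁰ + τ ∑ i, b i • K i` of the scheme with time step `τ`. -/
def step (rk : ExplicitRK s) (f : V → V) (τ : ℝ) (u : V) : V :=
  u + (τ : ℂ) • ∑ i : Fin s, rk.b i • rk.stage f τ u i

/-- The stability function: one step of size `1` for the scalar equation `u' = z u`, `u 0 = 1`. -/
def stabilityFunction (rk : ExplicitRK s) (z : ℂ) : ℂ :=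
  rk.step (fun w : ℂ => z * w) 1 1

/-- The real numbers `c j` are the normalized coefficients of the stability function:
`R z = ∑_{j ≤ s} c j * z ^ j / j!`, and `c j = 0` for `j > s`. -/
def HasStabilityCoeffs (rk : ExplicitRK s) (c : ℕ → ℝ) : Prop :=
  (∀ z : ℂ, rk.stabilityFunction z =
    ∑ j ∈ Finset.range (s + 1), (c j : ℂ) * (z ^ j / (j ! : ℂ))) ∧
  ∀ j : ℕ, s < j → c j = 0

/-- The scheme has order (at least) `p` for linear systems `u' = L u`: the error of one step,
started on an exact solution, is `O(τ ^ (p + 1))` as `τ → 0+`. -/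
def HasOrder (rk : ExplicitRK s) (p : ℕ) : Prop :=
  ∀ (n : ℕ) (L : Matrix (Fin n) (Fin n) ℂ) (u : ℝ → Fin n → ℂ),
    (∀ t : ℝ, HasDerivAt u (L *ᵥ u t) t) →
      (fun τ : ℝ => rk.step (fun w => L *ᵥ w) τ (u 0) - u τ)
        =O[𝓝[>] 0] (fun τ : ℝ => τ ^ (p + 1))

end ExplicitRK

/-- All eigenvalues have nonpositive real part, and those with vanishing real part are
non-defective (algebraic and geometric multiplicities coincide). -/
def LyapunovStable {n : ℕ} (L : Matrix (Fin n) (Fin n) ℂ) : Prop :=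
  ∀ μ : ℂ, Module.End.HasEigenvalue (Matrix.toLin' L) μ →
    μ.re ≤ 0 ∧
    (μ.re = 0 → L.charpoly.rootMultiplicity μ =
      Module.finrank ℂ (Module.End.eigenspace (Matrix.toLin' L) μ))

/-- The weighted norm `‖u‖_P = √⟨u, P u⟩`, for positive definite `P`. -/
def weightedNorm {n : ℕ} (P : Matrix (Fin n) (Fin n) ℂ) (u : Fin n → ℂ) : ℝ :=
  Real.sqrt (star u ⬝ᵥ (P *ᵥ u)).re

/-- Strong stability: for every Lyapunov stable `L` and every positive definite `P` with
`Lᴴ P + P L ≤ 0`, one has `‖u¹‖_P ≤ ‖u⁰‖_P` for all initial data and all sufficiently small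
time steps. -/
def ExplicitRK.StronglyStable {s : ℕ} (rk : ExplicitRK s) : Prop :=
  ∀ (n : ℕ) (L P : Matrix (Fin n) (Fin n) ℂ),
    LyapunovStable L → P.PosDef → (-(Lᴴ * P + P * L)).PosSemidef →
      ∃ τ₀ : ℝ, 0 < τ₀ ∧ ∀ τ : ℝ, 0 < τ → τ ≤ τ₀ → ∀ u : Fin n → ℂ,
        weightedNorm P (rk.step (fun w => L *ᵥ w) τ u) ≤ weightedNorm P u

end

/-!
The sign conditions say that one step loses to the exact flow `exp (τ L)` on a dissipative system.
Let `δ j` be the defect of the `j`-th Taylor coefficient of the stability polynomial `R`; order `p`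
means `δ j = 0` for `j ≤ p`.

On the scalar equation `u' = i u` the exact flow is unitary, so strong stability gives
`‖R(iτ)‖ ≤ 1` for small `τ`, and the leading term of `‖R(iτ)‖² - 1` bounds `δ (p + 1)` for odd `p`
and `δ (p + 2) - δ (p + 1)` for even `p`.

For `p = 2 k` the second inequality comes from a system whose energy decays only through one scalar
output `y = C u`: `d/dt ‖u‖² = -‖y‖²`. Choose initial data, depending on `τ`, whose output over
`[0, τ]` is to leading order `τ ^ k` times a polynomial of degree `k` in `t / τ` of our choice. The
exact flow dissipates `τ ^ (2 k + 1)` times the squared `L²` norm of that polynomial, while the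
defect changes the energy by `±δ (2 k + 1) τ ^ (2 k + 1)` times the square of its `k`-th derivative.
The shifted Legendre polynomial minimizes the `L²` norm for a prescribed leading coefficient, and
balancing the two terms for it gives exactly the stated threshold.
-/

open Polynomial Filter Asymptotics Complex InnerProductSpace

namespace ExplicitRK

variable {s : ℕ} {V W : Type*} [AddCommGroup V] [Module ℂ V] [AddCommGroup W] [Module ℂ W]

theorem map_stage (rk : ExplicitRK s) {f : V → V} {g : W → W} {τ σ : ℝ} (Φ : V →ₗ[ℂ] W)
    (h : ∀ v, (τ : ℂ) • Φ (f v) = (σ : ℂ) • g (Φ v)) (u : V) (i : Fin s) :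
    (τ : ℂ) • Φ (rk.stage f τ u i) = (σ : ℂ) • rk.stage g σ (Φ u) i := by
  induction hi : i.val using Nat.strong_induction_on generalizing i with
  | _ m ih =>
    subst hi
    rw [stage, h, stage]
    simp only [map_add, map_smul, map_sum, Finset.smul_sum, smul_comm _ (rk.a _ _),
      fun j : Fin i => ih j j.isLt ⟨j, j.isLt.trans i.isLt⟩ rfl]

theorem map_step (rk : ExplicitRK s) {f : V → V} {g : W → W} {τ σ : ℝ} (Φ : V →ₗ[ℂ] W)
    (h : ∀ v, (τ : ℂ) • Φ (f v) = (σ : ℂ) • g (Φ v)) (u : V) :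
    Φ (rk.step f τ u) = rk.step g σ (Φ u) := by
  simp only [step, map_add, map_smul, map_sum, Finset.smul_sum, smul_comm _ (rk.b _),
    rk.map_stage Φ h]

/-- The stability function as a formal polynomial: one step of size `1` for the equation
`u' = X u` in `ℂ[X]`, started at `1`. -/
noncomputable def stabilityPolynomial (rk : ExplicitRK s) : ℂ[X] :=
  rk.step (fun q => X * q) 1 1

theorem step_smul {A : Type*} [Ring A] [Algebra ℂ A] [Module A V] [IsScalarTower ℂ A V]
    (rk : ExplicitRK s) (a : A) (τ : ℝ) (u : V) :
    rk.step (a • ·) τ u = aeval ((τ : ℂ) • a) rk.stabilityPolynomial • u := by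
  let Φ : ℂ[X] →ₗ[ℂ] V :=
    (LinearMap.toSpanSingleton A V u).restrictScalars ℂ ∘ₗ (aeval ((τ : ℂ) • a)).toLinearMap
  refine Eq.trans ?_ (rk.map_step (g := (a • ·)) (σ := τ) Φ (fun q => ?_) 1).symm
  · simp [Φ]
  · simp [Φ, mul_smul]

theorem stabilityFunction_eq_eval (rk : ExplicitRK s) (z : ℂ) :
    rk.stabilityFunction z = rk.stabilityPolynomial.eval z := by
  simpa [stabilityFunction, coe_aeval_eq_eval] using rk.step_smul z 1 (1 : ℂ)

theorem HasStabilityCoeffs.coeff_stabilityPolynomial {rk : ExplicitRK s} {c : ℕ → ℝ}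
    (hc : rk.HasStabilityCoeffs c) (j : ℕ) :
    rk.stabilityPolynomial.coeff j = (c j : ℂ) / (j ! : ℂ) := by
  have h : rk.stabilityPolynomial =
      ∑ i ∈ Finset.range (s + 1), monomial i ((c i : ℂ) / (i ! : ℂ)) := by
    refine Polynomial.funext fun z => ?_
    rw [← rk.stabilityFunction_eq_eval, hc.1, eval_finsetSum]
    exact Finset.sum_congr rfl fun i _ => by rw [eval_monomial]; ring
  rw [h, finsetSum_coeff]
  simp only [coeff_monomial, Finset.sum_ite_eq', Finset.mem_range]
  split_ifs with hj
  · rfl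
  · rw [hc.2 j (by lia), ofReal_zero, zero_div]

theorem step_continuousLinearMap {E : Type*} [NormedAddCommGroup E] [NormedSpace ℂ E]
    (rk : ExplicitRK s) (T : E →L[ℂ] E) (τ : ℝ) (u : E) :
    rk.step (fun v => T v) τ u = aeval ((τ : ℂ) • T) rk.stabilityPolynomial u := by
  have : IsScalarTower ℂ (E →L[ℂ] E) E := ⟨fun _ _ _ => rfl⟩
  exact rk.step_smul T τ u

theorem toLp_step_mulVec {n : Type*} [Fintype n] [DecidableEq n] (rk : ExplicitRK s)
    (L : Matrix n n ℂ) (τ : ℝ) (u : n → ℂ) :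
    WithLp.toLp 2 (rk.step (L *ᵥ ·) τ u) =
      aeval ((τ : ℂ) • Matrix.toEuclideanCLM (𝕜 := ℂ) L) rk.stabilityPolynomial
        (WithLp.toLp 2 u) := by
  have hmap := rk.map_step (f := fun v => L *ᵥ v) (τ := τ) (σ := τ)
    (g := fun v : EuclideanSpace ℂ n => Matrix.toEuclideanCLM (𝕜 := ℂ) L v)
    (WithLp.linearEquiv 2 ℂ (n → ℂ)).symm.toLinearMap (fun v => rfl) u
  exact hmap.trans (rk.step_continuousLinearMap _ τ _)

end ExplicitRK

section ExponentialComparison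

variable {𝕜 : Type*} [RCLike 𝕜]

/-- The coefficient by which the polynomial `R` misses the exponential series in degree `j`. -/
noncomputable def expDefect (R : 𝕜[X]) (j : ℕ) : 𝕜 := R.coeff j - (j ! : 𝕜)⁻¹

variable {A : Type*} [NormedRing A] [NormedAlgebra 𝕜 A]

theorem continuous_exp_smul [CompleteSpace A] (a : A) :
    Continuous fun z : 𝕜 => NormedSpace.exp (z • a) :=
  continuous_iff_continuousAt.2 fun z => (hasDerivAt_exp_smul_const a z).continuousAt

theorem exp_smul_sub_sum_isBigO [CompleteSpace A] (a : A) (n : ℕ) :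
    (fun z : 𝕜 => NormedSpace.exp (z • a) - ∑ j ∈ Finset.range n, ((j ! : 𝕜)⁻¹ * z ^ j) • a ^ j)
      =O[𝓝 0] (· ^ n) := by
  have hlim : Tendsto (fun z : 𝕜 => z • a) (𝓝 0) (𝓝 0) :=
    (by fun_prop : Continuous fun z : 𝕜 => z • a).tendsto' _ _ (zero_smul 𝕜 a)
  have hexp := (NormedSpace.exp_hasFPowerSeriesAt_zero (𝕂 := 𝕜) (𝔸 := A)).isBigO_sub_partialSum_pow
    n |>.comp_tendsto hlim
  refine (hexp.congr_left fun z => ?_).trans (IsBigO.of_bound (‖a‖ ^ n) (.of_forall fun z => ?_))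
  · simp only [Function.comp_apply, zero_add, FormalMultilinearSeries.partialSum,
      NormedSpace.expSeries_apply_eq, _root_.smul_pow, smul_smul]
  · simp only [Function.comp_apply, norm_smul, norm_pow, mul_pow]
    simp only [norm_mul, norm_pow, norm_norm]
    exact (mul_comm (‖z‖ ^ n) (‖a‖ ^ n)).le

theorem aeval_smul_sub_sum_isBigO (R : 𝕜[X]) (a : A) (n : ℕ) :
    (fun z : 𝕜 => aeval (z • a) R - ∑ j ∈ Finset.range n, (R.coeff j * z ^ j) • a ^ j)
      =O[𝓝 0] (· ^ n) := by
  obtain ⟨S, hS⟩ : X ^ n ∣ R - ∑ j ∈ Finset.range n, monomial j (R.coeff j) := by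
    rw [X_pow_dvd_iff]
    intro j hj
    simp [finsetSum_coeff, coeff_monomial, hj]
  have hsplit (z : 𝕜) : aeval (z • a) R - ∑ j ∈ Finset.range n, (R.coeff j * z ^ j) • a ^ j =
      z ^ n • (a ^ n * aeval (z • a) S) := by
    have h := congrArg (aeval (z • a)) hS
    simpa only [map_sub, map_sum, aeval_monomial, map_mul, map_pow, aeval_X, _root_.smul_pow,
      ← Algebra.smul_def, smul_smul, smul_mul_assoc] using h
  have hcont : Continuous fun z : 𝕜 => a ^ n * aeval (z • a) S := by
    have := S.continuous_aeval (A := A)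
    fun_prop
  simpa only [hsplit, smul_eq_mul, mul_one] using
    (isBigO_refl (fun z : 𝕜 => z ^ n) (𝓝 0)).smul ((hcont.tendsto 0).isBigO_one 𝕜)

theorem aeval_smul_sub_exp_isBigO [CompleteSpace A] (R : 𝕜[X]) (a : A) (n : ℕ) :
    (fun z : 𝕜 => aeval (z • a) R - NormedSpace.exp (z • a) -
      ∑ j ∈ Finset.range n, (expDefect R j * z ^ j) • a ^ j) =O[𝓝 0] (· ^ n) := by
  refine ((aeval_smul_sub_sum_isBigO R a n).sub (exp_smul_sub_sum_isBigO a n)).congr_left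
    fun z => ?_
  simp only [expDefect, sub_mul, sub_smul, Finset.sum_sub_distrib]
  abel

theorem tendsto_inv_pow_smul_aeval_sub_exp [CompleteSpace A] (R : 𝕜[X]) (a : A) (n : ℕ) :
    Tendsto (fun z : 𝕜 => (z ^ n)⁻¹ • (aeval (z • a) R - NormedSpace.exp (z • a) -
      ∑ j ∈ Finset.range n, (expDefect R j * z ^ j) • a ^ j)) (𝓝[≠] 0)
      (𝓝 (expDefect R n • a ^ n)) := by
  have hO := ((aeval_smul_sub_exp_isBigO R a (n + 1)).trans_isLittleO
    (isLittleO_pow_pow n.lt_succ_self)).mono (nhdsWithin_le_nhds (s := {0}ᶜ))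
  rw [← tendsto_sub_nhds_zero_iff]
  refine hO.tendsto_inv_smul_nhds_zero.congr' ?_
  filter_upwards [self_mem_nhdsWithin] with z hz
  have hzn : z ^ n ≠ 0 := pow_ne_zero n hz
  rw [Finset.sum_range_succ, ← sub_sub, smul_sub, smul_smul, mul_left_comm, inv_mul_cancel₀ hzn,
    mul_one]

theorem X_pow_dvd_of_eval_isBigO {D : 𝕜[X]} {n : ℕ} {l : Filter 𝕜} [l.NeBot]
    (hl : l ≤ 𝓝[≠] 0) (h : (D.eval ·) =O[l] (· ^ n)) : X ^ n ∣ D := by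
  suffices ∀ j ≤ n, X ^ j ∣ D from this n le_rfl
  intro j
  induction j with
  | zero => simp
  | succ j ih =>
    intro hj
    obtain ⟨S, rfl⟩ := ih (by lia)
    have hzero : Tendsto (fun z => (z ^ j)⁻¹ • (X ^ j * S).eval z) l (𝓝 0) :=
      (h.trans_isLittleO ((isLittleO_pow_pow hj).mono
        (hl.trans nhdsWithin_le_nhds))).tendsto_inv_smul_nhds_zero
    have hS : Tendsto (S.eval ·) l (𝓝 (S.eval 0)) :=
      (S.continuous.tendsto 0).mono_left (hl.trans nhdsWithin_le_nhds)
    have hroot : S.eval 0 = 0 := by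
      refine tendsto_nhds_unique hS (hzero.congr' ?_)
      filter_upwards [hl self_mem_nhdsWithin] with z hz
      have hzj : z ^ j ≠ 0 := pow_ne_zero j hz
      simp [hzj]
    rw [pow_succ]
    exact mul_dvd_mul_left _ (X_dvd_iff.2 (by rwa [coeff_zero_eq_eval_zero]))

end ExponentialComparison

theorem map_ofReal_nhdsGT_zero_le : map ofReal (𝓝[>] (0 : ℝ)) ≤ 𝓝[≠] (0 : ℂ) :=
  tendsto_nhdsWithin_iff.2 ⟨(continuous_ofReal.tendsto' 0 0 ofReal_zero).mono_left
    nhdsWithin_le_nhds, by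
      filter_upwards [self_mem_nhdsWithin] with τ hτ using ofReal_ne_zero.2 (ne_of_gt hτ)⟩

namespace ExplicitRK

variable {s p : ℕ} {rk : ExplicitRK s}

theorem HasOrder.eval_sub_exp_isBigO (hord : rk.HasOrder p) :
    (fun τ : ℝ => rk.stabilityPolynomial.eval (τ : ℂ) - NormedSpace.exp (τ : ℂ))
      =O[𝓝[>] 0] fun τ : ℝ => τ ^ (p + 1) := by
  have hexp (t : ℝ) : HasDerivAt (fun (t : ℝ) (_ : Fin 1) => NormedSpace.exp (t : ℂ))
      ((1 : Matrix (Fin 1) (Fin 1) ℂ) *ᵥ fun _ => NormedSpace.exp (t : ℂ)) t := by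
    rw [Matrix.one_mulVec]
    exact hasDerivAt_pi.2 fun _ => (_root_.hasDerivAt_exp (x := (t : ℂ))).comp_ofReal
  refine (isBigO_pi.1 (hord 1 1 _ hexp) 0).congr_left fun τ => ?_
  have hstep := rk.map_step (f := ((1 : Matrix (Fin 1) (Fin 1) ℂ) *ᵥ ·)) (g := ((1 : ℂ) • ·))
    (τ := τ) (σ := τ) (LinearMap.proj 0) (fun v => by simp) fun _ => NormedSpace.exp ((0 : ℝ) : ℂ)
  rw [Pi.sub_apply]
  refine congrArg (· - _) (hstep.trans ?_)
  simpa [coe_aeval_eq_eval] using rk.step_smul (1 : ℂ) τ (1 : ℂ)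

theorem HasOrder.expDefect_eq_zero (hord : rk.HasOrder p) {j : ℕ} (hj : j ≤ p) :
    expDefect rk.stabilityPolynomial j = 0 := by
  let D : ℂ[X] :=
    ∑ i ∈ Finset.range (p + 1), monomial i (expDefect rk.stabilityPolynomial i)
  have hD : (D.eval ·) =O[map ofReal (𝓝[>] (0 : ℝ))] (· ^ (p + 1)) := by
    have hexpand := (aeval_smul_sub_exp_isBigO rk.stabilityPolynomial (1 : ℂ) (p + 1)).mono
      (map_ofReal_nhdsGT_zero_le.trans nhdsWithin_le_nhds)
    rw [isBigO_map] at hexpand ⊢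
    have hord' := hord.eval_sub_exp_isBigO.trans
      (IsBigO.of_bound (g := fun τ : ℝ => (τ : ℂ) ^ (p + 1)) 1 (.of_forall fun τ => by simp))
    refine (hord'.sub hexpand).congr_left fun τ => ?_
    simp [D, eval_finsetSum, coe_aeval_eq_eval]
  have hcoeff := X_pow_dvd_iff.1 (X_pow_dvd_of_eval_isBigO map_ofReal_nhdsGT_zero_le hD) j (by lia)
  simpa [D, finsetSum_coeff, coeff_monomial, Nat.lt_succ_of_le hj] using hcoeff

end ExplicitRK

section Energy

variable {𝕜 E α : Type*} [RCLike 𝕜] [NormedAddCommGroup E] [InnerProductSpace 𝕜 E]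

theorem tendsto_norm_add_smul_sq_sub_div {a w : α → E} {a₀ w₀ : E} {ε : α → ℝ} {l : Filter α}
    (ha : Tendsto a l (𝓝 a₀)) (hw : Tendsto w l (𝓝 w₀)) (hε : Tendsto ε l (𝓝[≠] 0)) :
    Tendsto (fun t => (‖a t + (ε t : 𝕜) • w t‖ ^ 2 - ‖a t‖ ^ 2) / ε t) l
      (𝓝 (2 * RCLike.re (inner 𝕜 a₀ w₀))) := by
  rw [tendsto_nhdsWithin_iff] at hε
  have hlim : Tendsto (fun t => 2 * RCLike.re (inner 𝕜 (a t) (w t)) + ε t * ‖w t‖ ^ 2) l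
      (𝓝 (2 * RCLike.re (inner 𝕜 a₀ w₀) + 0 * ‖w₀‖ ^ 2)) :=
    (((RCLike.continuous_re.tendsto _).comp (ha.inner hw)).const_mul 2).add
      (hε.1.mul (hw.norm.pow 2))
  rw [zero_mul, add_zero] at hlim
  refine hlim.congr' ?_
  filter_upwards [hε.2] with t ht
  have ht' : ε t ≠ 0 := ht
  rw [norm_add_sq (𝕜 := 𝕜), inner_smul_right, RCLike.re_ofReal_mul, norm_smul, RCLike.norm_ofReal,
    mul_pow, sq_abs]
  field_simp
  ring

end Energy

theorem tendsto_inv_pow_mul_eval_mul_I_sub (R : ℂ[X]) (n : ℕ) :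
    Tendsto (fun τ : ℝ => ((τ : ℂ) ^ n)⁻¹ * (R.eval (τ * I) - exp (τ * I) -
      ∑ j ∈ Finset.range n, expDefect R j * τ ^ j * I ^ j)) (𝓝[>] 0)
      (𝓝 (expDefect R n * I ^ n)) := by
  simpa [Function.comp_def, coe_aeval_eq_eval, ← exp_eq_exp_ℂ] using
    (tendsto_inv_pow_smul_aeval_sub_exp R I n).comp (map_ofReal_nhdsGT_zero_le)

theorem norm_exp_mul_I_add_mul_I_sq (t e : ℝ) :
    ‖exp (t * I) + e * I‖ ^ 2 = 1 + 2 * e * Real.sin t + e ^ 2 := by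
  rw [exp_mul_I, ← ofReal_cos, ← ofReal_sin, add_assoc, ← add_mul, ← ofReal_add,
    ← normSq_eq_norm_sq, normSq_add_mul_I]
  linear_combination Real.sin_sq_add_cos_sq t

theorem I_pow_two_mul (k : ℕ) : I ^ (2 * k) = ((-1 : ℝ) ^ k : ℝ) := by
  simp [pow_mul]

theorem tendsto_pow_nhdsGT_zero {m : ℕ} (hm : m ≠ 0) :
    Tendsto (fun τ : ℝ => τ ^ m) (𝓝[>] 0) (𝓝[≠] 0) := by
  refine tendsto_nhdsWithin_iff.2 ⟨((continuous_pow m).tendsto' 0 0 (zero_pow hm)).mono_left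
    nhdsWithin_le_nhds, ?_⟩
  filter_upwards [self_mem_nhdsWithin] with τ hτ using pow_ne_zero m (ne_of_gt hτ)

theorem tendsto_norm_eval_mul_I_sq_sub_div {R : ℂ[X]} {δ : ℕ → ℝ} {k : ℕ}
    (hδ : ∀ j, expDefect R j = δ j) (hzero : ∀ j ≤ 2 * k, δ j = 0) :
    Tendsto (fun τ : ℝ => (‖R.eval (τ * I)‖ ^ 2 -
        ‖exp (τ * I) + ((-1) ^ k * δ (2 * k + 1) * τ ^ (2 * k + 1) : ℝ) * I‖ ^ 2) /
      τ ^ (2 * k + 2)) (𝓝[>] 0) (𝓝 (-(2 * (-1) ^ k * δ (2 * k + 2)))) := by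
  let a (τ : ℝ) : ℂ := exp (τ * I) + ((-1) ^ k * δ (2 * k + 1) * τ ^ (2 * k + 1) : ℝ) * I
  let w (τ : ℝ) : ℂ := ((τ : ℂ) ^ (2 * k + 2))⁻¹ * (R.eval (τ * I) - a τ)
  have ha : Tendsto a (𝓝[>] 0) (𝓝 1) := by
    have : Continuous a := by fun_prop
    exact (this.tendsto' 0 1 (by simp [a])).mono_left nhdsWithin_le_nhds
  have hw : Tendsto w (𝓝[>] 0) (𝓝 ((-(-1) ^ k * δ (2 * k + 2) : ℝ) : ℂ)) := by
    have hlim := tendsto_inv_pow_mul_eval_mul_I_sub R (2 * k + 2)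
    have hI : I ^ (2 * k + 2) = ((-(-1) ^ k : ℝ) : ℂ) := by
      rw [← mul_add_one, I_pow_two_mul, pow_succ, mul_neg_one]
    rw [hδ, hI, ← ofReal_mul, mul_comm (δ _)] at hlim
    refine hlim.congr fun τ => ?_
    rw [Finset.sum_range_succ, Finset.sum_eq_zero fun j hj => by
      simp [hδ, hzero j (by simpa [Nat.lt_succ_iff] using hj)], hδ]
    simp only [w, a, pow_succ I, I_pow_two_mul]
    push_cast
    ring
  have hlim := tendsto_norm_add_smul_sq_sub_div (𝕜 := ℂ) ha hw
    (tendsto_pow_nhdsGT_zero (m := 2 * k + 2) (by lia))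
  rw [RCLike.inner_apply, map_one, mul_one, RCLike.re_to_complex, ofReal_re, neg_mul, mul_neg,
    ← mul_assoc] at hlim
  refine hlim.congr' ?_
  filter_upwards [self_mem_nhdsWithin] with τ hτ
  have hτ : (τ : ℂ) ^ (2 * k + 2) ≠ 0 := pow_ne_zero _ (ofReal_ne_zero.2 (ne_of_gt hτ))
  simp [w, a, hτ]

theorem neg_one_pow_mul_expDefect_sub_nonneg {R : ℂ[X]} {δ : ℕ → ℝ} {k : ℕ}
    (hδ : ∀ j, expDefect R j = δ j) (hzero : ∀ j ≤ 2 * k, δ j = 0)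
    (hR : ∀ᶠ τ : ℝ in 𝓝[>] 0, ‖R.eval (τ * I)‖ ≤ 1) :
    0 ≤ (-1) ^ k * (δ (2 * k + 2) - δ (2 * k + 1)) := by
  have hsinc : Tendsto (fun τ : ℝ => -2 * (-1) ^ k * δ (2 * k + 1) * Real.sinc τ) (𝓝[>] 0)
      (𝓝 (-2 * (-1) ^ k * δ (2 * k + 1) * 1)) :=
    ((Real.continuous_sinc.tendsto' 0 1 Real.sinc_zero).mono_left nhdsWithin_le_nhds).const_mul _
  have hle := le_of_tendsto_of_tendsto (tendsto_norm_eval_mul_I_sq_sub_div hδ hzero) hsinc ?_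
  · linarith
  filter_upwards [hR, self_mem_nhdsWithin] with τ hRτ hτ
  have hτ0 : τ ≠ 0 := ne_of_gt hτ
  set e := (-1) ^ k * δ (2 * k + 1) * τ ^ (2 * k + 1) with he
  have hrhs : -2 * (-1) ^ k * δ (2 * k + 1) * Real.sinc τ * τ ^ (2 * k + 2) =
      -(2 * e * Real.sin τ) := by
    rw [Real.sinc_of_ne_zero hτ0, he]
    field_simp
    ring
  rw [div_le_iff₀ (pow_pos hτ _), norm_exp_mul_I_add_mul_I_sq, hrhs]
  linarith [pow_le_one₀ (n := 2) (norm_nonneg _) hRτ, sq_nonneg e]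

theorem weightedNorm_one {n : ℕ} (u : Fin n → ℂ) :
    weightedNorm 1 u = ‖(WithLp.toLp 2 u : EuclideanSpace ℂ (Fin n))‖ := by
  rw [weightedNorm, Matrix.one_mulVec, EuclideanSpace.norm_eq]
  congr 1
  simp [dotProduct, ← normSq_eq_norm_sq, normSq_apply]

theorem lyapunovStable_smul_one {n : ℕ} {μ : ℂ} (hμ : μ.re ≤ 0) :
    LyapunovStable (μ • (1 : Matrix (Fin n) (Fin n) ℂ)) := by
  intro ν hν
  have htoLin : Matrix.toLin' (μ • (1 : Matrix (Fin n) (Fin n) ℂ)) = μ • LinearMap.id := by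
    rw [map_smul, Matrix.toLin'_one]
  obtain ⟨v, hv⟩ := hν.exists_hasEigenvector
  have hνμ : ν = μ := by
    have h := hv.apply_eq_smul
    rw [htoLin] at h
    exact (smul_left_injective ℂ hv.2 h).symm
  subst hνμ
  refine ⟨hμ, fun _ => ?_⟩
  have hspace : Module.End.eigenspace (ν • LinearMap.id : Module.End ℂ (Fin n → ℂ)) ν = ⊤ :=
    eq_top_iff.2 fun x _ => by simp
  rw [htoLin, hspace, finrank_top, Module.finrank_fin_fun, Matrix.smul_one_eq_diagonal,
    Matrix.charpoly_diagonal, Finset.prod_const, Finset.card_univ, Fintype.card_fin,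
    rootMultiplicity_X_sub_C_pow]

namespace ExplicitRK

variable {s : ℕ} {rk : ExplicitRK s}

theorem StronglyStable.eventually_norm_aeval_le (hst : rk.StronglyStable) {n : ℕ}
    {L : Matrix (Fin n) (Fin n) ℂ} (hL : LyapunovStable L) (hdiss : (-(Lᴴ + L)).PosSemidef) :
    ∀ᶠ τ : ℝ in 𝓝[>] 0, ∀ u, ‖aeval ((τ : ℂ) • Matrix.toEuclideanCLM (𝕜 := ℂ) L)
      rk.stabilityPolynomial u‖ ≤ ‖u‖ := by
  obtain ⟨τ₀, hτ₀, hle⟩ := hst n L 1 hL Matrix.PosDef.one (by rwa [mul_one, one_mul])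
  filter_upwards [Ioc_mem_nhdsGT hτ₀] with τ hτ u
  simpa only [weightedNorm_one, toLp_step_mulVec, WithLp.toLp_ofLp] using hle τ hτ.1 hτ.2 u.ofLp

theorem StronglyStable.eventually_norm_eval_mul_I_le (hst : rk.StronglyStable) :
    ∀ᶠ τ : ℝ in 𝓝[>] 0, ‖rk.stabilityPolynomial.eval (τ * I)‖ ≤ 1 := by
  have hdiss : (-((I • (1 : Matrix (Fin 1) (Fin 1) ℂ))ᴴ + I • 1)).PosSemidef := by
    simpa [Matrix.conjTranspose_smul] using Matrix.PosSemidef.zero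
  filter_upwards [hst.eventually_norm_aeval_le (lyapunovStable_smul_one (by simp)) hdiss]
    with τ hτ
  have h1 := hτ (EuclideanSpace.single 0 1)
  rw [map_smul, map_one, smul_smul, ← Algebra.algebraMap_eq_smul_one, aeval_algebraMap_apply,
    Algebra.algebraMap_eq_smul_one] at h1
  simpa [norm_smul, coe_aeval_eq_eval] using h1

end ExplicitRK

theorem tendsto_intervalIntegral_norm_sq_of_tendstoUniformlyOn {ι F : Type*}
    [NormedAddCommGroup F] {l : Filter ι} [l.IsCountablyGenerated] {f : ι → ℝ → F} {g : ℝ → F}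
    {a b : ℝ} (hf : ∀ i, Continuous (f i)) (hg : Continuous g)
    (hlim : TendstoUniformlyOn f g l (Set.uIcc a b)) :
    Tendsto (fun i => ∫ x in a..b, ‖f i x‖ ^ 2) l (𝓝 (∫ x in a..b, ‖g x‖ ^ 2)) := by
  refine intervalIntegral.tendsto_integral_filter_of_dominated_convergence
    (fun x => (‖g x‖ + 1) ^ 2) (.of_forall fun i => ((hf i).norm.pow 2).aestronglyMeasurable) ?_
    (((hg.norm.add continuous_const).pow 2).intervalIntegrable a b)
    (.of_forall fun x hx => (hlim.tendsto_at (Set.uIoc_subset_uIcc hx)).norm.pow 2)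
  filter_upwards [Metric.tendstoUniformlyOn_iff.1 hlim 1 one_pos] with i hi
  refine .of_forall fun x hx => ?_
  have hdist := (hi x (Set.uIoc_subset_uIcc hx)).le
  rw [dist_comm, dist_eq_norm] at hdist
  rw [norm_pow, norm_norm]
  gcongr
  linarith [norm_le_norm_add_norm_sub' (f i x) (g x)]

section Dissipation

variable {E F : Type*} [NormedAddCommGroup E] [InnerProductSpace ℂ E]
  [NormedAddCommGroup F] [InnerProductSpace ℂ F]

/-- The flow of `u' = T u` dissipates energy through the output `C`: the Hermitian form
`T* + T` is `-C* C`. It is stated on vectors, so that no adjoint is needed. -/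
def HasDissipation (T : E →L[ℂ] E) (C : E →L[ℂ] F) : Prop :=
  ∀ x y, inner ℂ (T x) y + inner ℂ x (T y) = -inner ℂ (C x) (C y)

namespace HasDissipation

variable {T : E →L[ℂ] E} {C : E →L[ℂ] F}

theorem two_mul_re_inner_self (h : HasDissipation T C) (x : E) :
    2 * (inner ℂ x (T x)).re = -‖C x‖ ^ 2 := by
  have hx := congrArg re (h x x)
  rw [add_re, neg_re, ← inner_conj_symm (T x) x, conj_re, inner_self_eq_norm_sq_to_K] at hx
  rw [two_mul, hx]
  simp [← ofReal_pow]

theorem inner_pow_eq_of_output_eq_zero (h : HasDissipation T C) {u : E} {k : ℕ}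
    (hC : ∀ i < k, C ((T ^ i) u) = 0) (y : E) :
    inner ℂ u ((T ^ k) y) = (-1) ^ k * inner ℂ ((T ^ k) u) y := by
  induction k generalizing y with
  | zero => simp
  | succ k ih =>
    have hk := h ((T ^ k) u) y
    rw [hC k k.lt_succ_self, inner_zero_left, neg_zero] at hk
    calc inner ℂ u ((T ^ (k + 1)) y)
        = (-1) ^ k * inner ℂ ((T ^ k) u) (T y) := by
          rw [pow_succ, mul_apply_eq_comp, ih fun i hi => hC i (by lia)]
      _ = (-1) ^ (k + 1) * inner ℂ ((T ^ (k + 1)) u) y := by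
          rw [eq_neg_of_add_eq_zero_right hk, pow_succ' T, mul_apply_eq_comp]
          ring

theorem two_mul_re_inner_pow_of_output_eq_zero (h : HasDissipation T C) {u : E} {k : ℕ}
    (hC : ∀ i < k, C ((T ^ i) u) = 0) :
    2 * (inner ℂ u ((T ^ (2 * k + 1)) u)).re = -((-1) ^ k * ‖C ((T ^ k) u)‖ ^ 2) := by
  have hpow : (T ^ (2 * k + 1)) u = (T ^ k) (T ((T ^ k) u)) := by
    rw [two_mul, add_assoc, pow_add, pow_succ', mul_apply_eq_comp,
      mul_apply_eq_comp]
  rw [hpow, h.inner_pow_eq_of_output_eq_zero hC,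
    show ((-1) ^ k : ℂ) = ((-1 : ℝ) ^ k : ℝ) by simp, re_ofReal_mul, mul_left_comm,
    h.two_mul_re_inner_self, mul_neg]

theorem re_neg_of_apply_eq_smul (h : HasDissipation T C) {x : E} {μ : ℂ} (hx : T x = μ • x)
    (hC : C x ≠ 0) : μ.re < 0 := by
  have hre := h.two_mul_re_inner_self x
  rw [hx, inner_smul_right, inner_self_eq_norm_sq_to_K] at hre
  change 2 * (μ * ((‖x‖ : ℂ) ^ 2)).re = _ at hre
  rw [← ofReal_pow, re_mul_ofReal] at hre
  have hpos : 0 < ‖C x‖ ^ 2 := by positivity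
  by_contra! hμ
  linarith [mul_nonneg hμ (sq_nonneg ‖x‖)]

variable [CompleteSpace E]

theorem hasDerivAt_norm_exp_smul_sq (h : HasDissipation T C) (u : E) (t : ℝ) :
    HasDerivAt (fun t : ℝ => ‖NormedSpace.exp ((t : ℂ) • T) u‖ ^ 2)
      (-‖C (NormedSpace.exp ((t : ℂ) • T) u)‖ ^ 2) t := by
  have hexp : HasDerivAt (fun t : ℝ => NormedSpace.exp ((t : ℂ) • T) u)
      (T (NormedSpace.exp ((t : ℂ) • T) u)) t :=
    (((ContinuousLinearMap.apply ℂ E u).hasFDerivAt.comp_hasDerivAt (t : ℂ)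
      (hasDerivAt_exp_smul_const' T (t : ℂ))).scomp t ofRealCLM.hasDerivAt).congr_deriv (by simp)
  have hinner := reCLM.hasFDerivAt.comp_hasDerivAt t (hexp.inner ℂ hexp)
  refine (hinner.congr_deriv ?_).congr_of_eventuallyEq (.of_forall fun t => ?_)
  · rw [reCLM_apply, add_comm, h, inner_self_eq_norm_sq_to_K]
    simp [← ofReal_pow]
  · rw [Function.comp_apply, reCLM_apply, inner_self_eq_norm_sq_to_K]
    simp [← ofReal_pow]

theorem norm_exp_smul_sq (h : HasDissipation T C) (u : E) (τ : ℝ) :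
    ‖NormedSpace.exp ((τ : ℂ) • T) u‖ ^ 2 =
      ‖u‖ ^ 2 - τ * ∫ x in (0 : ℝ)..1, ‖C (NormedSpace.exp ((τ * x : ℂ) • T) u)‖ ^ 2 := by
  have hcont : Continuous fun t : ℝ => -‖C (NormedSpace.exp ((t : ℂ) • T) u)‖ ^ 2 := by
    have := (continuous_exp_smul (𝕜 := ℂ) T).comp continuous_ofReal
    fun_prop
  have hftc := intervalIntegral.integral_eq_sub_of_hasDerivAt (a := 0) (b := τ)
    (fun t _ => h.hasDerivAt_norm_exp_smul_sq u t)
    (hcont.intervalIntegrable 0 τ)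
  have hscale := intervalIntegral.smul_integral_comp_mul_left (a := 0) (b := 1)
    (fun t : ℝ => ‖C (NormedSpace.exp ((t : ℂ) • T) u)‖ ^ 2) τ
  simp only [ofReal_mul, mul_zero, mul_one, smul_eq_mul] at hscale
  rw [intervalIntegral.integral_neg] at hftc
  rw [ofReal_zero, zero_smul, NormedSpace.exp_zero, one_apply_eq_self] at hftc
  linarith

end HasDissipation

variable {T : E →L[ℂ] E} {C : E →L[ℂ] F} {u : ℝ → E} {u₀ : E} {y : ℕ → F} {k : ℕ}

theorem HasDissipation.two_mul_re_inner_pow_limit (h : HasDissipation T C)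
    (hu : Tendsto u (𝓝[>] 0) (𝓝 u₀))
    (hy : ∀ τ, ∀ i ≤ k, C ((T ^ i) (u τ)) = (τ : ℂ) ^ (k - i) • y i) :
    2 * (inner ℂ u₀ ((T ^ (2 * k + 1)) u₀)).re = -((-1) ^ k * ‖y k‖ ^ 2) := by
  have houtput {i : ℕ} (hi : i ≤ k) : C ((T ^ i) u₀) = (0 : ℂ) ^ (k - i) • y i := by
    refine tendsto_nhds_unique (((C.comp (T ^ i)).continuous.tendsto u₀).comp hu)
      (Tendsto.congr (fun τ => (hy τ i hi).symm) ?_)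
    have : Continuous fun τ : ℝ => (τ : ℂ) ^ (k - i) • y i := by fun_prop
    exact (this.tendsto' 0 _ (by simp)).mono_left nhdsWithin_le_nhds
  rw [h.two_mul_re_inner_pow_of_output_eq_zero fun i hi => by
    rw [houtput hi.le, zero_pow (by lia), zero_smul], houtput le_rfl, Nat.sub_self, pow_zero,
    one_smul]

variable [CompleteSpace E]

theorem exp_mul_smul_sub_sum_isLittleO (T : E →L[ℂ] E) (k : ℕ) :
    (fun q : ℝ × ℝ => NormedSpace.exp ((q.1 * q.2 : ℂ) • T) -
        ∑ i ∈ Finset.range (k + 1), ((i ! : ℂ)⁻¹ * (q.1 * q.2) ^ i) • T ^ i)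
      =o[𝓝[>] 0 ×ˢ 𝓟 (Set.Icc 0 1)] fun q => (q.1 : ℂ) ^ k := by
  have hτ : Tendsto (fun q : ℝ × ℝ => (q.1 : ℂ)) (𝓝[>] 0 ×ˢ 𝓟 (Set.Icc 0 1)) (𝓝 0) :=
    (tendsto_nhds_of_tendsto_nhdsWithin map_ofReal_nhdsGT_zero_le).comp tendsto_fst
  have hx : (fun q : ℝ × ℝ => (q.1 * q.2 : ℂ)) =O[𝓝[>] 0 ×ˢ 𝓟 (Set.Icc 0 1)]
      fun q => (q.1 : ℂ) := by
    refine IsBigO.of_bound 1 ?_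
    filter_upwards [tendsto_snd.eventually (eventually_mem_principal (Set.Icc (0 : ℝ) 1))]
      with q hq
    rw [norm_mul, norm_real q.2, Real.norm_of_nonneg hq.1, one_mul]
    exact mul_le_of_le_one_right (norm_nonneg _) hq.2
  exact (((exp_smul_sub_sum_isBigO T (k + 1)).comp_tendsto (hx.trans_tendsto hτ)).trans
    (hx.pow (k + 1))).trans_isLittleO ((isLittleO_pow_pow k.lt_succ_self).comp_tendsto hτ)

theorem tendstoUniformlyOn_inv_pow_smul_output_exp (hu : Tendsto u (𝓝[>] 0) (𝓝 u₀))
    (hy : ∀ τ, ∀ i ≤ k, C ((T ^ i) (u τ)) = (τ : ℂ) ^ (k - i) • y i) :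
    TendstoUniformlyOn
      (fun τ x : ℝ => ((τ : ℂ) ^ k)⁻¹ • C (NormedSpace.exp ((τ * x : ℂ) • T) (u τ)))
      (fun x : ℝ => ∑ i ∈ Finset.range (k + 1), ((i ! : ℂ)⁻¹ * x ^ i) • y i)
      (𝓝[>] 0) (Set.Icc 0 1) := by
  let rem (q : ℝ × ℝ) : E →L[ℂ] E := NormedSpace.exp ((q.1 * q.2 : ℂ) • T) -
    ∑ i ∈ Finset.range (k + 1), ((i ! : ℂ)⁻¹ * (q.1 * q.2) ^ i) • T ^ i
  have hrem : (fun q => C (rem q (u q.1))) =o[𝓝[>] 0 ×ˢ 𝓟 (Set.Icc 0 1)]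
      fun q => (q.1 : ℂ) ^ k := by
    have hbound : (fun q => C (rem q (u q.1))) =O[𝓝[>] 0 ×ˢ 𝓟 (Set.Icc 0 1)]
        fun q => ‖rem q‖ * ‖u q.1‖ :=
      IsBigO.of_bound ‖C‖ (.of_forall fun q => by
        rw [norm_mul, norm_norm, norm_norm]
        exact C.le_opNorm_of_le ((rem q).le_opNorm _))
    have hu1 : (fun q : ℝ × ℝ => ‖u q.1‖) =O[𝓝[>] 0 ×ˢ 𝓟 (Set.Icc 0 1)]
        fun _ => (1 : ℂ) :=
      (hu.comp tendsto_fst).norm.isBigO_one ℂ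
    exact hbound.trans_isLittleO (((exp_mul_smul_sub_sum_isLittleO T k).norm_left.mul_isBigO
      hu1).congr_right fun q => mul_one _)
  have hpos : ∀ᶠ q : ℝ × ℝ in 𝓝[>] 0 ×ˢ 𝓟 (Set.Icc 0 1), (q.1 : ℂ) ≠ 0 :=
    tendsto_fst.eventually (eventually_map.1 (map_ofReal_nhdsGT_zero_le self_mem_nhdsWithin))
  rw [tendstoUniformlyOn_iff_tendsto, tendsto_uniformity_iff_dist_tendsto_zero]
  refine hrem.tendsto_inv_smul_nhds_zero.norm.congr' ?_ |>.trans (by simp)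
  filter_upwards [hpos] with q hq
  rw [dist_comm, dist_eq_norm]
  congr 1
  have hscale : ∑ i ∈ Finset.range (k + 1), ((i ! : ℂ)⁻¹ * q.2 ^ i) • y i = ((q.1 : ℂ) ^ k)⁻¹ •
      C ((∑ i ∈ Finset.range (k + 1), ((i ! : ℂ)⁻¹ * (q.1 * q.2) ^ i) • T ^ i) (u q.1)) := by
    simp only [sum_apply, map_sum, smul_apply, map_smul, Finset.smul_sum]
    refine Finset.sum_congr rfl fun i hi => ?_
    have hi : i ≤ k := Nat.lt_succ_iff.1 (Finset.mem_range.1 hi)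
    rw [hy _ i hi, smul_smul, smul_smul, ← pow_mul_pow_sub (q.1 : ℂ) hi]
    congr 1
    rw [mul_pow]
    field_simp
  rw [hscale, ← smul_sub, ← map_sub]
  simp [rem]

theorem HasDissipation.tendsto_norm_exp_sq_sub_div (h : HasDissipation T C)
    (hu : Tendsto u (𝓝[>] 0) (𝓝 u₀))
    (hy : ∀ τ, ∀ i ≤ k, C ((T ^ i) (u τ)) = (τ : ℂ) ^ (k - i) • y i) :
    Tendsto (fun τ : ℝ => (‖NormedSpace.exp ((τ : ℂ) • T) (u τ)‖ ^ 2 - ‖u τ‖ ^ 2) /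
        τ ^ (2 * k + 1)) (𝓝[>] 0)
      (𝓝 (-∫ x in (0 : ℝ)..1,
        ‖∑ i ∈ Finset.range (k + 1), ((i ! : ℂ)⁻¹ * x ^ i) • y i‖ ^ 2)) := by
  have hcont (τ : ℝ) : Continuous fun x : ℝ =>
      ((τ : ℂ) ^ k)⁻¹ • C (NormedSpace.exp ((τ * x : ℂ) • T) (u τ)) := by
    have := (continuous_exp_smul (𝕜 := ℂ) T).comp
      (by fun_prop : Continuous fun x : ℝ => (τ * x : ℂ))
    fun_prop
  have huniform := tendstoUniformlyOn_inv_pow_smul_output_exp hu hy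
  rw [← Set.uIcc_of_le zero_le_one] at huniform
  refine (tendsto_intervalIntegral_norm_sq_of_tendstoUniformlyOn hcont (by fun_prop)
    huniform).neg.congr' ?_
  filter_upwards [self_mem_nhdsWithin] with τ hτ
  have hτ0 : τ ≠ 0 := ne_of_gt hτ
  simp only [norm_smul, mul_pow, intervalIntegral.integral_const_mul]
  rw [h.norm_exp_smul_sq, norm_inv, norm_pow, norm_real, Real.norm_of_nonneg (le_of_lt hτ)]
  field_simp
  ring

theorem tendsto_norm_aeval_sq_sub_norm_exp_sq_div {R : ℂ[X]} {n : ℕ} {δ : ℝ} (T : E →L[ℂ] E)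
    (hzero : ∀ j < n, expDefect R j = 0) (hδ : expDefect R n = δ) (hn : n ≠ 0)
    (hu : Tendsto u (𝓝[>] 0) (𝓝 u₀)) :
    Tendsto (fun τ : ℝ => (‖aeval ((τ : ℂ) • T) R (u τ)‖ ^ 2 -
        ‖NormedSpace.exp ((τ : ℂ) • T) (u τ)‖ ^ 2) / τ ^ n) (𝓝[>] 0)
      (𝓝 (δ * (2 * (inner ℂ u₀ ((T ^ n) u₀)).re))) := by
  have happly {A : ℝ → E →L[ℂ] E} {A₀ : E →L[ℂ] E} (hA : Tendsto A (𝓝[>] 0) (𝓝 A₀)) :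
      Tendsto (fun τ => A τ (u τ)) (𝓝[>] 0) (𝓝 (A₀ u₀)) :=
    (isBoundedBilinearMap_apply.continuous.tendsto (A₀, u₀)).comp (hA.prodMk_nhds hu)
  have hexp : Tendsto (fun τ : ℝ => NormedSpace.exp ((τ : ℂ) • T)) (𝓝[>] 0) (𝓝 1) :=
    (((continuous_exp_smul (𝕜 := ℂ) T).comp continuous_ofReal).tendsto'
      0 1 (by simp)).mono_left nhdsWithin_le_nhds
  have hdiff : Tendsto (fun τ : ℝ => ((τ : ℂ) ^ n)⁻¹ •
      (aeval ((τ : ℂ) • T) R - NormedSpace.exp ((τ : ℂ) • T))) (𝓝[>] 0) (𝓝 ((δ : ℂ) • T ^ n)) := by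
    rw [← hδ]
    refine ((tendsto_inv_pow_smul_aeval_sub_exp R T n).comp map_ofReal_nhdsGT_zero_le).congr
      fun τ => ?_
    rw [Function.comp_apply, Finset.sum_eq_zero fun j hj => by
      rw [hzero j (Finset.mem_range.1 hj), zero_mul, zero_smul], sub_zero]
  have hlim := tendsto_norm_add_smul_sq_sub_div (𝕜 := ℂ) (happly hexp) (happly hdiff)
    (tendsto_pow_nhdsGT_zero hn)
  rw [one_apply_eq_self, smul_apply, inner_smul_right, RCLike.re_to_complex, re_ofReal_mul,
    mul_left_comm] at hlim
  refine hlim.congr' ?_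
  filter_upwards [self_mem_nhdsWithin] with τ hτ
  have hτ : (τ : ℂ) ^ n ≠ 0 := pow_ne_zero _ (ofReal_ne_zero.2 (ne_of_gt hτ))
  simp [hτ]

theorem HasDissipation.outputEnergy_add_nonneg (h : HasDissipation T C) {R : ℂ[X]} {δ : ℝ}
    (hzero : ∀ j ≤ 2 * k, expDefect R j = 0) (hδ : expDefect R (2 * k + 1) = δ)
    (hu : Tendsto u (𝓝[>] 0) (𝓝 u₀))
    (hy : ∀ τ, ∀ i ≤ k, C ((T ^ i) (u τ)) = (τ : ℂ) ^ (k - i) • y i)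
    (hR : ∀ᶠ τ : ℝ in 𝓝[>] 0, ‖aeval ((τ : ℂ) • T) R (u τ)‖ ≤ ‖u τ‖) :
    0 ≤ (∫ x in (0 : ℝ)..1, ‖∑ i ∈ Finset.range (k + 1), ((i ! : ℂ)⁻¹ * x ^ i) • y i‖ ^ 2) +
      (-1) ^ k * δ * ‖y k‖ ^ 2 := by
  have hlim := (tendsto_norm_aeval_sq_sub_norm_exp_sq_div T
    (fun j hj => hzero j (Nat.lt_succ_iff.1 hj)) hδ (by lia) hu).add
    (h.tendsto_norm_exp_sq_sub_div hu hy)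
  rw [h.two_mul_re_inner_pow_limit hu hy] at hlim
  have hle := le_of_tendsto hlim (b := 0) ?_
  · linarith
  filter_upwards [hR, self_mem_nhdsWithin] with τ hRτ hτ
  rw [← add_div, sub_add_sub_cancel]
  exact div_nonpos_of_nonpos_of_nonneg (sub_nonpos.2 (by gcongr)) (pow_pos hτ _).le

end Dissipation

section Legendre

theorem integral_eval_mul_iterate_derivative {a b : ℝ} {n : ℕ} (f : ℝ[X]) {g : ℝ[X]}
    (ha : (X - C a) ^ n ∣ g) (hb : (X - C b) ^ n ∣ g) :
    ∫ x in a..b, f.eval x * (derivative^[n] g).eval x =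
      (-1) ^ n * ∫ x in a..b, (derivative^[n] f).eval x * g.eval x := by
  induction n generalizing f with
  | zero => simp
  | succ n ih =>
    have eval_eq_zero {r : ℝ} (hr : (X - C r) ^ (n + 1) ∣ g) : (derivative^[n] g).eval r = 0 := by
      have h := pow_sub_dvd_iterate_derivative_of_pow_dvd n hr
      rwa [Nat.add_sub_cancel_left, pow_one, dvd_iff_isRoot] at h
    have by_parts := intervalIntegral.integral_mul_deriv_eq_deriv_mul (a := a) (b := b)
      (fun x _ ↦ f.hasDerivAt x) (fun x _ ↦ (derivative^[n] g).hasDerivAt x)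
      ((derivative f).continuous.intervalIntegrable _ _)
      ((derivative (derivative^[n] g)).continuous.intervalIntegrable _ _)
    rw [eval_eq_zero ha, eval_eq_zero hb, mul_zero, mul_zero, sub_zero, zero_sub,
      ih (derivative f) ((pow_dvd_pow _ n.le_succ).trans ha)
        ((pow_dvd_pow _ n.le_succ).trans hb)] at by_parts
    rw [Function.iterate_succ_apply', by_parts, Function.iterate_succ_apply, pow_succ', neg_one_mul,
      neg_mul]

theorem integral_pow_mul_one_sub_pow (a b : ℕ) :
    ∫ x in (0 : ℝ)..1, x ^ a * (1 - x) ^ b = (a ! * b ! / (a + b + 1)! : ℝ) := by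
  have hbeta := Gamma_mul_Gamma_eq_betaIntegral (s := (a : ℂ) + 1) (t := (b : ℂ) + 1)
    (by simpa using a.cast_add_one_pos) (by simpa using b.cast_add_one_pos)
  rw [Gamma_nat_eq_factorial, Gamma_nat_eq_factorial,
    show (a : ℂ) + 1 + (b + 1) = ((a + b + 1 : ℕ) : ℂ) + 1 by push_cast; ring,
    Gamma_nat_eq_factorial, betaIntegral] at hbeta
  simp only [add_sub_cancel_right, cpow_natCast] at hbeta
  rw [eq_div_iff (by positivity), mul_comm, ← Complex.ofReal_inj, Complex.ofReal_mul,
    ← intervalIntegral.integral_ofReal]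
  push_cast
  exact hbeta.symm

theorem iterate_derivative_natDegree {R : Type*} [Semiring R] (f : R[X]) :
    derivative^[f.natDegree] f = C (f.natDegree ! • f.leadingCoeff) := by
  ext m
  rw [coeff_iterate_derivative, coeff_C]
  split_ifs with hm
  · rw [hm, zero_add, Nat.descFactorial_self, coeff_natDegree]
  · rw [coeff_eq_zero_of_natDegree_lt (by lia), smul_zero]

theorem integral_shiftedLegendre_sq (k : ℕ) :
    ∫ x in (0 : ℝ)..1, ((shiftedLegendre k).map (Int.castRingHom ℝ)).eval x ^ 2 =
      (2 * k + 1 : ℝ)⁻¹ := by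
  set P := (shiftedLegendre k).map (Int.castRingHom ℝ)
  have rodrigues : derivative^[k] (X ^ k * (1 - X) ^ k : ℝ[X]) = (k ! : ℝ[X]) * P := by
    have h := congrArg (Polynomial.map (Int.castRingHom ℝ)) (factorial_mul_shiftedLegendre_eq k)
    simpa [← iterate_derivative_map, P] using h.symm
  have hdeg : P.natDegree = k := by
    rw [natDegree_map_eq_of_injective (Int.castRingHom ℝ).injective_int, natDegree_shiftedLegendre]
  have hlead : P.leadingCoeff = (-1) ^ k * ((2 * k).choose k : ℝ) := by
    rw [leadingCoeff, hdeg, coeff_map, coeff_shiftedLegendre, two_mul]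
    simp
  have htop : derivative^[k] P = C (k ! * ((-1) ^ k * ((2 * k).choose k : ℝ))) := by
    rw [← hlead, ← nsmul_eq_mul]
    conv_lhs => rw [← hdeg, iterate_derivative_natDegree, hdeg]
  have by_parts := integral_eval_mul_iterate_derivative (a := 0) (b := 1) (n := k) P
    (g := X ^ k * (1 - X) ^ k) (by simp)
    ((pow_dvd_pow_of_dvd ⟨-1, by simp⟩ k).mul_left _)
  rw [rodrigues, htop] at by_parts
  simp only [eval_mul, eval_natCast, eval_C, eval_pow, eval_X, eval_sub, eval_one,
    mul_left_comm _ (k ! : ℝ), intervalIntegral.integral_const_mul, integral_pow_mul_one_sub_pow,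
    ← two_mul, ← sq] at by_parts
  have hchoose : ((2 * k).choose k : ℝ) * k ! * k ! = (2 * k)! := by
    exact_mod_cast two_mul k ▸ Nat.add_choose_mul_factorial_mul_factorial k k
  apply mul_left_cancel₀ (by positivity : (k ! : ℝ) ≠ 0)
  calc _ = ((-1) ^ k * (-1) ^ k) * k ! * ((2 * k).choose k * k ! * k !) / ((2 * k + 1)! : ℝ) := by
        rw [by_parts]; ring
    _ = k ! * (2 * k + 1 : ℝ)⁻¹ := by
        rw [hchoose, Nat.factorial_succ, ← mul_pow, neg_one_mul, neg_neg, one_pow]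
        push_cast
        field_simp

end Legendre

section RankOneDamping

theorem exists_rightInverse_of_observable {𝕜 E : Type*} [RCLike 𝕜] [NormedAddCommGroup E]
    [NormedSpace 𝕜 E] [FiniteDimensional 𝕜 E] {n : ℕ} (hn : Module.finrank 𝕜 E = n)
    {T : E →L[𝕜] E} {C : E →L[𝕜] 𝕜} (hobs : ∀ x, (∀ i < n, C ((T ^ i) x) = 0) → x = 0) :
    ∃ G : (Fin n → 𝕜) →L[𝕜] E, ∀ v (i : Fin n), C ((T ^ (i : ℕ)) (G v)) = v i := by
  let outputs : E →ₗ[𝕜] Fin n → 𝕜 := LinearMap.pi fun i => (C ∘L T ^ (i : ℕ)).toLinearMap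
  have hinj : Function.Injective outputs := by
    rw [← LinearMap.ker_eq_bot, LinearMap.ker_eq_bot']
    exact fun x hx => hobs x fun i hi => congrFun hx ⟨i, hi⟩
  let e := LinearEquiv.ofInjectiveOfFinrankEq outputs hinj (by rw [hn, Module.finrank_fin_fun])
  exact ⟨e.symm.toLinearMap.toContinuousLinearMap, fun v => congrFun (e.apply_symm_apply v)⟩

theorem inner_toEuclideanCLM_add {ι : Type*} [Fintype ι] [DecidableEq ι] (L : Matrix ι ι ℂ)
    (x y : EuclideanSpace ℂ ι) :
    inner ℂ (Matrix.toEuclideanCLM (𝕜 := ℂ) L x) y +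
        inner ℂ x (Matrix.toEuclideanCLM (𝕜 := ℂ) L y) =
      inner ℂ x (Matrix.toEuclideanCLM (𝕜 := ℂ) (Lᴴ + L) y) := by
  rw [map_add, ← Matrix.star_eq_conjTranspose, map_star, add_apply,
    inner_add_right, ContinuousLinearMap.star_eq_adjoint, ContinuousLinearMap.adjoint_inner_right]

/-- The output functional `x ↦ ∑ m, x m`, written as a pairing with `(1, …, 1)`. -/
noncomputable def coordinateSum (n : ℕ) : EuclideanSpace ℂ (Fin n) →L[ℂ] ℂ :=
  innerSL ℂ (WithLp.toLp 2 1)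

/-- Undamped oscillators with frequencies `ω`, coupled only through a damping of their sum. This is
the dissipative system on which the second obstruction for even orders shows up. -/
noncomputable def rankOneDamped {n : ℕ} (ω : Fin n → ℝ) : Matrix (Fin n) (Fin n) ℂ :=
  Matrix.diagonal (fun m => I * ω m) - (1 / 2 : ℂ) • Matrix.vecMulVec 1 1

variable {n : ℕ} {ω : Fin n → ℝ}

theorem coordinateSum_apply (x : EuclideanSpace ℂ (Fin n)) : coordinateSum n x = ∑ m, x m := by
  simp [coordinateSum, PiLp.inner_apply]

theorem toEuclideanCLM_vecMulVec_one (x : EuclideanSpace ℂ (Fin n)) :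
    Matrix.toEuclideanCLM (𝕜 := ℂ) (Matrix.vecMulVec 1 1) x =
      coordinateSum n x • WithLp.toLp 2 1 := by
  ext m
  rw [Matrix.ofLp_toEuclideanCLM, Matrix.vecMulVec_mulVec, coordinateSum_apply]
  simp [one_dotProduct]

theorem conjTranspose_rankOneDamped_add (ω : Fin n → ℝ) :
    (rankOneDamped ω)ᴴ + rankOneDamped ω = -Matrix.vecMulVec 1 1 := by
  ext i j
  by_cases h : i = j
  · subst h
    simp [rankOneDamped]
    ring
  · simp [rankOneDamped, h]
    norm_num

theorem hasDissipation_rankOneDamped (ω : Fin n → ℝ) :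
    HasDissipation (Matrix.toEuclideanCLM (𝕜 := ℂ) (rankOneDamped ω)) (coordinateSum n) := by
  intro x y
  rw [inner_toEuclideanCLM_add, conjTranspose_rankOneDamped_add, map_neg,
    neg_apply, inner_neg_right, toEuclideanCLM_vecMulVec_one, inner_smul_right,
    ← inner_conj_symm x]
  rfl

theorem toEuclideanCLM_rankOneDamped_of_coordinateSum_eq_zero {x : EuclideanSpace ℂ (Fin n)}
    (hx : coordinateSum n x = 0) (m : Fin n) :
    Matrix.toEuclideanCLM (𝕜 := ℂ) (rankOneDamped ω) x m = I * ω m * x m := by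
  rw [rankOneDamped, map_sub, map_smul, sub_apply, smul_apply, toEuclideanCLM_vecMulVec_one, hx,
    zero_smul, smul_zero, sub_zero, Matrix.ofLp_toEuclideanCLM, Matrix.mulVec_diagonal]

theorem eq_zero_of_coordinateSum_rankOneDamped_pow_eq_zero (hω : Function.Injective ω)
    {x : EuclideanSpace ℂ (Fin n)}
    (hx : ∀ i < n, coordinateSum n
      ((Matrix.toEuclideanCLM (𝕜 := ℂ) (rankOneDamped ω) ^ i) x) = 0) : x = 0 := by
  have hpow : ∀ i < n, ∀ m, ((Matrix.toEuclideanCLM (𝕜 := ℂ) (rankOneDamped ω) ^ i) x) m =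
      (I * ω m) ^ i * x m := by
    intro i hi m
    induction i with
    | zero => simp
    | succ i ih =>
      rw [pow_succ', mul_apply_eq_comp,
        toEuclideanCLM_rankOneDamped_of_coordinateSum_eq_zero (hx i (by lia)), ih (by lia),
        ← mul_assoc, ← pow_succ']
  have hvec : x.ofLp ᵥ* Matrix.vandermonde (fun m => I * ω m) = 0 := by
    ext i
    have h := hx i i.2
    rw [coordinateSum_apply] at h
    simp only [hpow i i.2] at h
    simpa only [Matrix.vecMul, dotProduct, Matrix.vandermonde_apply, Pi.zero_apply,
      mul_comm] using h
  refine WithLp.ofLp_injective 2 (Matrix.eq_zero_of_vecMul_eq_zero ?_ hvec)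
  refine Matrix.det_vandermonde_ne_zero_iff.2 fun a b hab => hω ?_
  simpa using hab

theorem lyapunovStable_rankOneDamped (hω : Function.Injective ω) :
    LyapunovStable (rankOneDamped ω) := by
  intro μ hμ
  obtain ⟨v, hv⟩ := hμ.exists_hasEigenvector
  set T := Matrix.toEuclideanCLM (𝕜 := ℂ) (rankOneDamped ω)
  set x : EuclideanSpace ℂ (Fin n) := WithLp.toLp 2 v
  have hTx : T x = μ • x := congrArg (WithLp.toLp 2) hv.apply_eq_smul
  have hpow (i : ℕ) : (T ^ i) x = μ ^ i • x := by
    induction i with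
    | zero => simp
    | succ i ih => rw [pow_succ', mul_apply_eq_comp, ih, map_smul, hTx, smul_smul, pow_succ]
  have hsum : coordinateSum n x ≠ 0 := by
    intro h0
    refine hv.2 (congrArg WithLp.ofLp (eq_zero_of_coordinateSum_rankOneDamped_pow_eq_zero hω
      (x := x) fun i _ => ?_))
    rw [hpow, map_smul, h0, smul_zero]
  have hre := (hasDissipation_rankOneDamped ω).re_neg_of_apply_eq_smul hTx hsum
  exact ⟨hre.le, fun h0 => absurd h0 hre.ne⟩

end RankOneDamping

namespace ExplicitRK

variable {s : ℕ} {rk : ExplicitRK s} {c : ℕ → ℝ} {k : ℕ}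

theorem StronglyStable.inv_add_expDefect_mul_nonneg (hst : rk.StronglyStable) {δ : ℝ}
    (hzero : ∀ j ≤ 2 * k, expDefect rk.stabilityPolynomial j = 0)
    (hδ : expDefect rk.stabilityPolynomial (2 * k + 1) = δ) :
    0 ≤ (2 * k + 1 : ℝ)⁻¹ + (-1) ^ k * δ * (k ! * (2 * k).choose k : ℝ) ^ 2 := by
  let ω : Fin (k + 1) → ℝ := fun m => m
  have hω : Function.Injective ω := Nat.cast_injective.comp Fin.val_injective
  let P := (shiftedLegendre k).map (Int.castRingHom ℝ)
  let y : ℕ → ℂ := fun i => i ! * P.coeff i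
  obtain ⟨G, hG⟩ := exists_rightInverse_of_observable finrank_euclideanSpace_fin
    fun _ => eq_zero_of_coordinateSum_rankOneDamped_pow_eq_zero hω
  let u : ℝ → EuclideanSpace ℂ (Fin (k + 1)) := fun τ => G fun i => (τ : ℂ) ^ (k - i : ℕ) • y i
  have hu : Continuous u := by fun_prop
  have hdiss : (-((rankOneDamped ω)ᴴ + rankOneDamped ω)).PosSemidef := by
    rw [conjTranspose_rankOneDamped_add, neg_neg]
    simpa using Matrix.posSemidef_vecMulVec_self_star (1 : Fin (k + 1) → ℂ)
  have henergy := (hasDissipation_rankOneDamped ω).outputEnergy_add_nonneg (y := y) hzero hδ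
    ((hu.tendsto 0).mono_left nhdsWithin_le_nhds)
    (fun τ i hi => hG _ ⟨i, Nat.lt_succ_iff.2 hi⟩)
    ((hst.eventually_norm_aeval_le (lyapunovStable_rankOneDamped hω) hdiss).mono fun τ h => h (u τ))
  have houtput (x : ℝ) : ∑ i ∈ Finset.range (k + 1), ((i ! : ℂ)⁻¹ * x ^ i) • y i = P.eval x := by
    have hdeg : P.natDegree = k := by
      rw [natDegree_map_eq_of_injective (Int.castRingHom ℝ).injective_int,
        natDegree_shiftedLegendre]
    rw [eval_eq_sum_range, hdeg]
    push_cast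
    refine Finset.sum_congr rfl fun i _ => ?_
    have : (i ! : ℂ) ≠ 0 := by exact_mod_cast i.factorial_ne_zero
    simp only [y, smul_eq_mul]
    field_simp
  have hlead : ‖y k‖ = k ! * (2 * k).choose k := by
    simp [y, P, coeff_shiftedLegendre, two_mul]
  simpa only [houtput, norm_real, Real.norm_eq_abs, sq_abs, P, integral_shiftedLegendre_sq, hlead]
    using henergy

theorem HasStabilityCoeffs.expDefect_eq (hc : rk.HasStabilityCoeffs c) (j : ℕ) :
    expDefect rk.stabilityPolynomial j = ((c j - 1) / j ! : ℝ) := by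
  rw [expDefect, hc.coeff_stabilityPolynomial, sub_div, one_div]
  push_cast
  rfl

theorem HasStabilityCoeffs.eq_one (hc : rk.HasStabilityCoeffs c) {p : ℕ} (hord : rk.HasOrder p)
    {j : ℕ} (hj : j ≤ p) : c j = 1 := by
  have h := hord.expDefect_eq_zero hj
  rw [hc.expDefect_eq, ofReal_eq_zero, div_eq_zero_iff] at h
  exact sub_eq_zero.1 (h.resolve_right (by positivity))

theorem StronglyStable.neg_one_pow_mul_coeff_nonneg (hst : rk.StronglyStable)
    (hc : rk.HasStabilityCoeffs c) (hone : ∀ j ≤ 2 * k, c j = 1) :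
    0 ≤ (-1) ^ k * (c (2 * k + 2) - (2 * k + 2) * c (2 * k + 1) + (2 * k + 1)) := by
  have hnonneg := neg_one_pow_mul_expDefect_sub_nonneg (k := k) hc.expDefect_eq
    (fun j hj => by rw [hone j hj, sub_self, zero_div]) hst.eventually_norm_eval_mul_I_le
  have hfac : ((2 * k + 2)! : ℝ) = (2 * k + 2) * (2 * k + 1)! := by
    rw [Nat.factorial_succ]
    push_cast
    ring
  calc 0 ≤ ((2 * k + 2)! : ℝ) * _ := mul_nonneg (by positivity) hnonneg
    _ = _ := by
      rw [hfac]
      field_simp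
      ring

theorem StronglyStable.one_add_coeff_mul_choose_nonneg (hst : rk.StronglyStable)
    (hc : rk.HasStabilityCoeffs c) (hone : ∀ j ≤ 2 * k, c j = 1) :
    0 ≤ 1 + (-1) ^ k * (c (2 * k + 1) - 1) * ((2 * k).choose k : ℝ) := by
  have hnonneg := hst.inv_add_expDefect_mul_nonneg
    (fun j hj => by rw [hc.expDefect_eq, hone j hj, sub_self, zero_div, ofReal_zero])
    (hc.expDefect_eq (2 * k + 1))
  have hfac : ((2 * k + 1)! : ℝ) = (2 * k + 1) * ((2 * k).choose k * k ! * k !) := by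
    rw [Nat.factorial_succ, two_mul k, ← Nat.add_choose_mul_factorial_mul_factorial k k]
    push_cast
    ring
  calc 0 ≤ (2 * k + 1 : ℝ) * _ := mul_nonneg (by positivity) hnonneg
    _ = _ := by
      rw [hfac]
      field_simp

end ExplicitRK

theorem mainTheorem4 {s : ℕ} (rk : ExplicitRK s) (p : ℕ) (hp : 1 ≤ p) (hord : rk.HasOrder p)
    (c : ℕ → ℝ) (hc : rk.HasStabilityCoeffs c) :
    (Odd p → (-1 : ℝ) ^ ((p + 1) / 2) * (1 - c (p + 1)) < 0 → ¬ rk.StronglyStable) ∧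
    (Even p →
      ((-1 : ℝ) ^ (p / 2) * (c (p + 2) - ((p : ℝ) + 2) * c (p + 1) + ((p : ℝ) + 1)) < 0 ∨
        1 + (-1 : ℝ) ^ (p / 2) * (c (p + 1) - 1) * (p.choose (p / 2) : ℝ) < 0) →
      ¬ rk.StronglyStable) := by
  have hone : ∀ j ≤ p, c j = 1 := fun j => hc.eq_one hord
  constructor
  · rintro ⟨k, rfl⟩ hneg hst
    have h := hst.neg_one_pow_mul_coeff_nonneg (k := k) hc fun j hj => hone j (by lia)
    rw [hone (2 * k + 1) le_rfl] at h
    rw [show (2 * k + 1 + 1) / 2 = k + 1 by lia, pow_succ] at hneg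
    linarith
  · rintro hp_even hneg hst
    obtain ⟨k, rfl⟩ := hp_even.two_dvd
    rw [Nat.mul_div_cancel_left k two_pos] at hneg
    push_cast at hneg
    exact hneg.elim (hst.neg_one_pow_mul_coeff_nonneg hc hone).not_gt
      (hst.one_add_coeff_mul_choose_nonneg hc hone).not_gt
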